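/- Let $\mathcal{C}$ be a finite dimensional $2$-vector space over $\mathbb{C}$, i.e. a $\mathbb{C}$-linear abelian category that is $\mathbb{C}$-linearly equivalent to a product of finitely many copies of the category $\mathrm{Vec}$ of finite dimensional complex vector spaces. Let a finite group $Q$ act on $\mathcal{C}$ by $\mathbb{C}$-linear autoequivalences, i.e. let a homomorphism of $2$-groups $Q\to\underline{\mathrm{Aut}}(\mathcal{C})$ be given; write $q\cdot M$ for the action, so that there are coherent natural isomorphisms $(pq)\cdot M\simeq p\cdot(q\cdot M)$ and $1\cdot M\simeq M$. Let $\mathcal{C}^Q$ be the equivariantization: its objects are objects $M$ of $\mathcal{C}$ with isomorphisms $\varphi_q:q\cdot M\simeq M$, $q\in Q$, compatible with these structure isomorphisms ($\varphi_{pq}=\varphi_p\circ(p\cdot\varphi_q)$ and $\varphi_1=\mathrm{id}$, up to the structure isomorphisms), and its morphisms are the morphisms of $\mathcal{C}$ that commute with the $\varphi_q$. Let $I_{\mathcal{C}}$ be the set of isomorphism classes of simple objects of $\mathcal{C}$, with the induced action of $Q$, let $Q\ltimes I_{\mathcal{C}}$ be the action groupoid, and choose representatives $c_i\in i$ for $i\in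 I_{\mathcal{C}}$, arbitrarily. For an arrow of $Q\ltimes I_{\mathcal{C}}$ from $i$ to $j=q\cdot i$ labeled by $q\in Q$ put $$\ell_{q,i}:=\mathrm{Hom}_{\mathcal{C}}(c_j,q\cdot c_i).$$ These spaces are lines. With the composition $\ell_{p,j}\otimes\ell_{q,i}\simeq\ell_{pq,i}$, $b\otimes a\mapsto (p\cdot a)\circ b$ (followed by $p\cdot(q\cdot c_i)\simeq (pq)\cdot c_i$), and the units $c_i\simeq 1\cdot c_i$ in $\ell_{1,i}$, they form an $S^1$-gerbe (a $\mathbb{C}^\times$-central extension) $\widehat{Q\ltimes I_{\mathcal{C}}}$ on the groupoid $Q\ltimes I_{\mathcal{C}}$. Let $\mathrm{Rep}'\,\widehat{Q\ltimes I_{\mathcal{C}}}$ be the category of its $S^1$-twisted representations: its objects are families of finite dimensional complex vector spaces $(M_i)_{i\in I_{\mathcal{C}}}$ with linear maps $\ell_{q,i}\otimes M_i\to M_{q\cdot i}$ compatible with composition and units (these maps are then isomorphisms), and its morphisms are families of linear maps commuting with them. Then there is a $\mathbb{C}$-linear equivalence of categories $$\mathcal{C}^Q\simeq\mathrm{Rep}'\,\widehat{Q\ltimes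 I_{\mathcal{C}}}.$$ -/

import Mathlib

open CategoryTheory MonoidalCategory

universe w' w v u

noncomputable section

/-! ### 2-vector spaces, linear actions of groups on categories, equivariantization -/

/-- A finite-dimensional 2-vector space over `ℂ`: a `ℂ`-linear category which is `ℂ`-linearly
equivalent to a product of finitely many copies of the category of finite-dimensional complex
vector spaces. (Linearity into the product category is checked on each factor.) -/
class IsTwoVectorSpace (C : Type u) [Category.{v} C] [Preadditive C] [Linear ℂ C] : Prop where
  exists_equivalence : ∃ (n : ℕ) (e : C ≌ (Fin n → FGModuleCat.{v} ℂ)), ∀ i : Fin n,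
    (e.functor ⋙ Pi.eval (fun _ : Fin n => FGModuleCat.{v} ℂ) i).Additive ∧
    (e.functor ⋙ Pi.eval (fun _ : Fin n => FGModuleCat.{v} ℂ) i).Linear ℂ

/-- An action of the group `Q` on the category `C`, i.e. a monoidal functor from the discrete
monoidal category on `Q` to endofunctors of `C` (with `p ⊗ q` going to "first `q`, then `p`"), is
`ℂ`-linear if each `q` acts by a `ℂ`-linear functor. Since `Q` is a group, every `q` acts by an
autoequivalence, so such an action is a map of 2-groups from `Q` to the 2-group of `ℂ`-linear
autoequivalences of `C`. -/
class IsLinearAction (Q : Type w) [Group Q] (C : Type u) [Category.{v} C] [Preadditive C]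
    [Linear ℂ C] [MonoidalLeftAction (Discrete Q) C] : Prop where
  additive : ∀ q : Discrete Q, (MonoidalLeftAction.actionLeft C q).Additive
  linear : ∀ q : Discrete Q, (MonoidalLeftAction.actionLeft C q).Linear ℂ

section Equivariant

open scoped MonoidalLeftAction

/-- An object of the equivariantization `C^Q`: an object `M` of `C` with isomorphisms
`φ_q : q · M ≅ M` such that `φ_{pq} = φ_p ∘ (p · φ_q)` modulo the structure isomorphism
`(pq) · M ≅ p · (q · M)`, and such that `φ_1` is the structure isomorphism `1 · M ≅ M`. -/
structure EquivariantObject (Q : Type w) [Group Q] (C : Type u) [Category.{v} C]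
    [MonoidalLeftAction (Discrete Q) C] where
  obj : C
  iso : ∀ q : Discrete Q, (q ⊙ₗ obj : C) ≅ obj
  iso_unit : (iso (𝟙_ (Discrete Q))).hom = (λₗ obj).hom
  iso_mul : ∀ p q : Discrete Q,
    (iso (p ⊗ q)).hom = (αₗ p q obj).hom ≫ p ⊴ₗ (iso q).hom ≫ (iso p).hom

namespace EquivariantObject

variable {Q : Type w} [Group Q] {C : Type u} [Category.{v} C] [MonoidalLeftAction (Discrete Q) C]

/-- A morphism of equivariant objects: a morphism in `C` commuting with the `φ_q`. -/
@[ext]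
structure Hom (M N : EquivariantObject Q C) where
  hom : M.obj ⟶ N.obj
  comm : ∀ q : Discrete Q, (M.iso q).hom ≫ hom = q ⊴ₗ hom ≫ (N.iso q).hom

instance : Category (EquivariantObject Q C) where
  Hom M N := Hom M N
  id M := ⟨𝟙 _, by simp⟩
  comp f g := ⟨f.hom ≫ g.hom, fun q => by
    rw [← Category.assoc, f.comm, Category.assoc, g.comm]
    simp⟩
  id_comp f := Hom.ext (Category.id_comp f.hom)
  comp_id f := Hom.ext (Category.comp_id f.hom)
  assoc f g h := Hom.ext (Category.assoc f.hom g.hom h.hom)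

@[simp] theorem comp_hom {M N P : EquivariantObject Q C} (f : M ⟶ N) (g : N ⟶ P) :
    (f ≫ g).hom = f.hom ≫ g.hom := rfl

theorem actionRight_add (Q : Type w) [Group Q] {C : Type u} [Category.{v} C]
    [MonoidalLeftAction (Discrete Q) C] [Preadditive C] [Linear ℂ C] [IsLinearAction Q C]
    (q : Discrete Q) {X Y : C} (f g : X ⟶ Y) : q ⊴ₗ (f + g) = q ⊴ₗ f + q ⊴ₗ g :=
  (IsLinearAction.additive (C := C) q).map_add

theorem actionRight_smul (Q : Type w) [Group Q] {C : Type u} [Category.{v} C]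
    [MonoidalLeftAction (Discrete Q) C] [Preadditive C] [Linear ℂ C] [IsLinearAction Q C]
    (q : Discrete Q) {X Y : C} (r : ℂ) (f : X ⟶ Y) : q ⊴ₗ (r • f) = r • q ⊴ₗ f :=
  (IsLinearAction.linear (C := C) q).map_smul f r

section Linear

variable [Preadditive C] [Linear ℂ C] [IsLinearAction Q C]

/-- The morphisms `M ⟶ N` of equivariant objects, as a linear subspace of the morphisms in `C`. -/
def homSubmodule (M N : EquivariantObject Q C) : Submodule ℂ (M.obj ⟶ N.obj) where
  carrier := {f | ∀ q : Discrete Q, (M.iso q).hom ≫ f = q ⊴ₗ f ≫ (N.iso q).hom}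
  add_mem' {f g} hf hg q := by
    simp [actionRight_add, hf q, hg q]
  zero_mem' q := by
    have := actionRight_smul Q q (0 : ℂ) (0 : M.obj ⟶ N.obj)
    simp only [zero_smul] at this
    simp [this]
  smul_mem' r f hf q := by
    simp [actionRight_smul, hf q]

def homEquiv (M N : EquivariantObject Q C) : (M ⟶ N) ≃ homSubmodule M N where
  toFun f := ⟨f.hom, f.comm⟩
  invFun f := ⟨f.1, f.2⟩

instance (M N : EquivariantObject Q C) : AddCommGroup (M ⟶ N) := (homEquiv M N).addCommGroup

instance (M N : EquivariantObject Q C) : Module ℂ (M ⟶ N) := (homEquiv M N).module ℂ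

@[simp] theorem add_hom {M N : EquivariantObject Q C} (f g : M ⟶ N) :
    (f + g).hom = f.hom + g.hom := rfl

@[simp] theorem smul_hom {M N : EquivariantObject Q C} (r : ℂ) (f : M ⟶ N) :
    (r • f).hom = r • f.hom := rfl

instance : Preadditive (EquivariantObject Q C) where
  add_comp _ _ _ f f' g := Hom.ext (by simp)
  comp_add _ _ _ f g g' := Hom.ext (by simp)

instance : Linear ℂ (EquivariantObject Q C) where
  smul_comp _ _ _ r f g := Hom.ext (by simp)
  comp_smul _ _ _ f r g := Hom.ext (by simp)

end Linear

end EquivariantObject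

end Equivariant

/-! ### `S¹`-gerbes on groupoids and their twisted representations -/

/-- An `S¹`-gerbe (that is, a `ℂ^×`-central extension) on a groupoid `G`, given by its lines: a
complex line `ℓ_f` for every arrow `f`, with associative and unital composition isomorphisms
`ℓ_g ⊗ ℓ_f ≅ ℓ_{g ∘ f}`. The composition is indexed by an arrow `h` together with a proof that `h`
is the composite of `f` and `g`; this only serves to avoid transports along equalities of arrows.
The arrows of the corresponding central extension are the nonzero elements of the lines. -/
structure LineGerbe (G : Type u) [Category.{v} G] [IsGroupoid G] where
  line : ∀ {i j : G}, (i ⟶ j) → Type w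
  [addCommGroup : ∀ {i j : G} (f : i ⟶ j), AddCommGroup (line f)]
  [module : ∀ {i j : G} (f : i ⟶ j), Module ℂ (line f)]
  finrank_line : ∀ {i j : G} (f : i ⟶ j), Module.finrank ℂ (line f) = 1
  mul : ∀ {i j k : G} {f : i ⟶ j} {g : j ⟶ k} {h : i ⟶ k}, f ≫ g = h →
    (line g →ₗ[ℂ] line f →ₗ[ℂ] line h)
  mul_bijective : ∀ {i j k : G} {f : i ⟶ j} {g : j ⟶ k} {h : i ⟶ k} (e : f ≫ g = h),
    Function.Bijective (TensorProduct.lift (mul e))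
  one : ∀ i : G, line (𝟙 i)
  mul_one : ∀ {i j : G} (f : i ⟶ j) (a : line f), mul (Category.id_comp f) a (one i) = a
  one_mul : ∀ {i j : G} (f : i ⟶ j) (a : line f), mul (Category.comp_id f) (one j) a = a
  mul_assoc : ∀ {i j k l : G} {f : i ⟶ j} {g : j ⟶ k} {h : k ⟶ l} {fg : i ⟶ k} {gh : j ⟶ l}
    {fgh : i ⟶ l} (e₁ : f ≫ g = fg) (e₂ : g ≫ h = gh) (e₃ : fg ≫ h = fgh) (e₄ : f ≫ gh = fgh)
    (a : line f) (b : line g) (c : line h),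
    mul e₄ (mul e₂ c b) a = mul e₃ c (mul e₁ b a)

attribute [instance] LineGerbe.addCommGroup LineGerbe.module

/-- An `S¹`-twisted (finite-dimensional) representation of an `S¹`-gerbe on a groupoid `G`: a
finite-dimensional vector space `M_i` for every object `i` of `G` and linear maps
`ℓ_f ⊗ M_i → M_j` for every arrow `f : i ⟶ j`, compatible with composition and units
(hence isomorphisms). Equivalently, a representation of the central extension on which `ℂ^×` acts
by scalars. -/
structure TwistedRep {G : Type u} [Category.{v} G] [IsGroupoid G] (L : LineGerbe.{w} G) where
  space : G → Type w'
  [addCommGroup : ∀ i, AddCommGroup (space i)]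
  [module : ∀ i, Module ℂ (space i)]
  [finite : ∀ i, Module.Finite ℂ (space i)]
  act : ∀ {i j : G} (f : i ⟶ j), L.line f →ₗ[ℂ] space i →ₗ[ℂ] space j
  one_act : ∀ (i : G) (m : space i), act (𝟙 i) (L.one i) m = m
  mul_act : ∀ {i j k : G} {f : i ⟶ j} {g : j ⟶ k} {h : i ⟶ k} (e : f ≫ g = h)
    (b : L.line g) (a : L.line f) (m : space i), act h (L.mul e b a) m = act g b (act f a m)

attribute [instance] TwistedRep.addCommGroup TwistedRep.module TwistedRep.finite

namespace TwistedRep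

variable {G : Type u} [Category.{v} G] [IsGroupoid G] {L : LineGerbe.{w} G}

/-- A morphism of twisted representations: linear maps `M_i → N_i` commuting with the action of
all elements of the lines. -/
@[ext]
structure Hom (M N : TwistedRep.{w'} L) where
  hom : ∀ i : G, M.space i →ₗ[ℂ] N.space i
  comm : ∀ {i j : G} (f : i ⟶ j) (a : L.line f) (m : M.space i),
    hom j (M.act f a m) = N.act f a (hom i m)

instance : Category (TwistedRep.{w'} L) where
  Hom M N := Hom M N
  id M := ⟨fun _ => LinearMap.id, fun _ _ _ => rfl⟩
  comp f g := ⟨fun i => g.hom i ∘ₗ f.hom i, fun k a m => by simp [f.comm, g.comm]⟩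

/-- The morphisms `M ⟶ N` of twisted representations, as a linear subspace of the space of all
families of linear maps `M_i → N_i`. -/
def homSubmodule (M N : TwistedRep.{w'} L) :
    Submodule ℂ (∀ i : G, M.space i →ₗ[ℂ] N.space i) where
  carrier := {φ | ∀ (i j : G) (f : i ⟶ j) (a : L.line f) (m : M.space i),
    φ j (M.act f a m) = N.act f a (φ i m)}
  add_mem' {φ ψ} hφ hψ i j f a m := by simp [hφ i j f a m, hψ i j f a m]
  zero_mem' i j f a m := by simp
  smul_mem' r φ hφ i j f a m := by simp [hφ i j f a m]

def homEquiv (M N : TwistedRep.{w'} L) : (M ⟶ N) ≃ homSubmodule M N where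
  toFun f := ⟨f.hom, fun _ _ k a m => f.comm k a m⟩
  invFun f := ⟨f.1, fun k a m => f.2 _ _ k a m⟩

instance (M N : TwistedRep.{w'} L) : AddCommGroup (M ⟶ N) := (homEquiv M N).addCommGroup

instance (M N : TwistedRep.{w'} L) : Module ℂ (M ⟶ N) := (homEquiv M N).module ℂ

@[simp] theorem comp_hom {M N P : TwistedRep.{w'} L} (f : M ⟶ N) (g : N ⟶ P) (i : G) :
    (f ≫ g).hom i = g.hom i ∘ₗ f.hom i := rfl

@[simp] theorem add_hom {M N : TwistedRep.{w'} L} (f g : M ⟶ N) (i : G) :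
    (f + g).hom i = f.hom i + g.hom i := rfl

@[simp] theorem smul_hom {M N : TwistedRep.{w'} L} (r : ℂ) (f : M ⟶ N) (i : G) :
    (r • f).hom i = r • f.hom i := rfl

instance : Preadditive (TwistedRep.{w'} L) where
  add_comp _ _ _ f f' g := Hom.ext (funext fun i => by
    simp only [comp_hom, add_hom, LinearMap.comp_add])
  comp_add _ _ _ f g g' := Hom.ext (funext fun i => by
    simp only [comp_hom, add_hom, LinearMap.add_comp])

instance : Linear ℂ (TwistedRep.{w'} L) where
  smul_comp _ _ _ r f g := Hom.ext (funext fun i => by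
    simp only [comp_hom, smul_hom, LinearMap.comp_smul])
  comp_smul _ _ _ f r g := Hom.ext (funext fun i => by
    simp only [comp_hom, smul_hom, LinearMap.smul_comp])

end TwistedRep

/-! ### The set `I_C` of isomorphism classes of simple objects, with its action of `Q` -/

/-- Simple objects of `C`. -/
structure SimpleObject (C : Type u) [Category.{v} C] [Preadditive C] where
  obj : C
  simple : Simple obj

instance SimpleObject.setoid (C : Type u) [Category.{v} C] [Preadditive C] :
    Setoid (SimpleObject C) where
  r X Y := Nonempty (X.obj ≅ Y.obj)
  iseqv := ⟨fun _ => ⟨Iso.refl _⟩, fun ⟨e⟩ => ⟨e.symm⟩, fun ⟨e⟩ ⟨e'⟩ => ⟨e ≪≫ e'⟩⟩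

/-- The set `I_C` of isomorphism classes of simple objects of `C`. -/
def SimpleClass (C : Type u) [Category.{v} C] [Preadditive C] : Type u :=
  Quotient (SimpleObject.setoid C)

/-- The isomorphism class of a simple object. -/
def SimpleClass.mk {C : Type u} [Category.{v} C] [Preadditive C] (X : SimpleObject C) :
    SimpleClass C :=
  Quotient.mk _ X

section SimpleAction

open scoped MonoidalLeftAction

variable {Q : Type w} [Group Q] {C : Type u} [Category.{v} C]
  [MonoidalLeftAction (Discrete Q) C]

/-- The structure isomorphism `r · X ≅ p · (q · X)` for `r = pq`. -/
def actionMulIso {p q r : Discrete Q} (h : p ⊗ q = r) (X : C) : (r ⊙ₗ X : C) ≅ p ⊙ₗ q ⊙ₗ X :=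
  eqToIso (by rw [h]) ≪≫ αₗ p q X

/-- The structure isomorphism `r · X ≅ X` for `r = 1`. -/
def actionOneIso {r : Discrete Q} (h : r = 𝟙_ (Discrete Q)) (X : C) : (r ⊙ₗ X : C) ≅ X :=
  eqToIso (by rw [h]) ≪≫ λₗ X

theorem actionHomLeft_eq_eqToHom {p q : Discrete Q} (f : p ⟶ q) (X : C) :
    f ⊵ₗ X = eqToHom (by rw [Discrete.ext (Discrete.eq_of_hom f)]) := by
  obtain rfl : p = q := Discrete.ext (Discrete.eq_of_hom f)
  obtain rfl : f = 𝟙 p := Subsingleton.elim _ _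
  simp

theorem actionMulIso_naturality {p q r : Discrete Q} (h : p ⊗ q = r) {X Y : C} (f : X ⟶ Y) :
    (actionMulIso h X).hom ≫ p ⊴ₗ q ⊴ₗ f = r ⊴ₗ f ≫ (actionMulIso h Y).hom := by
  subst h
  simp [actionMulIso]

theorem actionOneIso_naturality {r : Discrete Q} (h : r = 𝟙_ (Discrete Q)) {X Y : C}
    (f : X ⟶ Y) : (actionOneIso h X).hom ≫ f = r ⊴ₗ f ≫ (actionOneIso h Y).hom := by
  subst h
  simp [actionOneIso]

theorem actionMulIso_assoc {p q r pq qr pqr : Discrete Q} (e₁ : p ⊗ q = pq) (e₂ : q ⊗ r = qr)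
    (e₃ : pq ⊗ r = pqr) (e₄ : p ⊗ qr = pqr) (X : C) :
    (actionMulIso e₄ X).hom ≫ p ⊴ₗ (actionMulIso e₂ X).hom =
      (actionMulIso e₃ X).hom ≫ (actionMulIso e₁ (r ⊙ₗ X)).hom := by
  subst e₁ e₂ e₃
  have := MonoidalLeftAction.associator_actionHom p q r X
  rw [actionHomLeft_eq_eqToHom] at this
  simpa [actionMulIso] using this

theorem actionMulIso_one_left {p q r : Discrete Q} (h : p ⊗ q = r) (hp : p = 𝟙_ (Discrete Q))
    (hr : r = q) (X : C) :
    (actionMulIso h X).hom ≫ (actionOneIso hp (q ⊙ₗ X)).hom = eqToHom (by rw [hr]) := by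
  subst hp hr
  have := MonoidalLeftAction.leftUnitor_actionHom r X
  rw [actionHomLeft_eq_eqToHom] at this
  simp [actionMulIso, actionOneIso, ← this]

theorem actionMulIso_one_right {p q r : Discrete Q} (h : p ⊗ q = r) (hq : q = 𝟙_ (Discrete Q))
    (hr : r = p) (X : C) :
    (actionMulIso h X).hom ≫ p ⊴ₗ (actionOneIso hq X).hom = eqToHom (by rw [hr]) := by
  subst hq hr
  have := MonoidalLeftAction.rightUnitor_actionHom r X
  rw [actionHomLeft_eq_eqToHom] at this
  simp [actionMulIso, actionOneIso, ← this]

theorem discrete_inv_tensor (q : Discrete Q) : Discrete.mk q.as⁻¹ ⊗ q = 𝟙_ (Discrete Q) :=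
  Discrete.ext (inv_mul_cancel q.as)

theorem discrete_tensor_inv (q : Discrete Q) : q ⊗ Discrete.mk q.as⁻¹ = 𝟙_ (Discrete Q) :=
  Discrete.ext (mul_inv_cancel q.as)

theorem actionInvMul_naturality (q : Discrete Q) {X Y : C} (f : X ⟶ Y) :
    f ≫ (λₗ[Discrete Q] Y).inv ≫ (actionMulIso (discrete_inv_tensor q) Y).hom =
      ((λₗ[Discrete Q] X).inv ≫ (actionMulIso (discrete_inv_tensor q) X).hom) ≫
        Discrete.mk q.as⁻¹ ⊴ₗ q ⊴ₗ f := by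
  rw [Category.assoc, actionMulIso_naturality]
  simp

theorem actionMulInv_naturality (q : Discrete Q) {X Y : C} (f : X ⟶ Y) :
    q ⊴ₗ Discrete.mk q.as⁻¹ ⊴ₗ f ≫ (actionMulIso (discrete_tensor_inv q) Y).inv ≫
        (λₗ[Discrete Q] Y).hom =
      ((actionMulIso (discrete_tensor_inv q) X).inv ≫ (λₗ[Discrete Q] X).hom) ≫ f := by
  have h := actionMulIso_naturality (discrete_tensor_inv q) f
  rw [← Iso.eq_inv_comp] at h
  rw [h]
  simp

/-- Each element of `Q` acts by an autoequivalence. -/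
instance actionLeft_isEquivalence (q : Discrete Q) :
    (MonoidalLeftAction.actionLeft C q).IsEquivalence :=
  (CategoryTheory.Equivalence.mk (MonoidalLeftAction.actionLeft C q)
    (MonoidalLeftAction.actionLeft C (Discrete.mk q.as⁻¹))
    (NatIso.ofComponents
      (fun X => (λₗ X).symm ≪≫ actionMulIso (discrete_inv_tensor q) X)
      (fun f => actionInvMul_naturality q f))
    (NatIso.ofComponents
      (fun X => (actionMulIso (discrete_tensor_inv q) X).symm ≪≫ λₗ X)
      (fun f => actionMulInv_naturality q f))).isEquivalence_functor

variable [Preadditive C]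

/-- The action of `Q` on the set `I_C`. -/
instance SimpleClass.mulAction : MulAction Q (SimpleClass C) where
  smul q := Quotient.map (sa := SimpleObject.setoid C) (sb := SimpleObject.setoid C)
    (fun X => ⟨Discrete.mk q ⊙ₗ X.obj,
      haveI := X.simple; simple_obj (MonoidalLeftAction.actionLeft C (Discrete.mk q)) X.obj⟩)
    (fun _ _ ⟨e⟩ => ⟨(MonoidalLeftAction.actionLeft C (Discrete.mk q)).mapIso e⟩)
  one_smul i := Quotient.inductionOn i fun X => Quotient.sound ⟨λₗ[Discrete Q] X.obj⟩
  mul_smul _ _ i := Quotient.inductionOn i fun X => Quotient.sound ⟨actionMulIso rfl X.obj⟩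

end SimpleAction

/-! ### The `S¹`-gerbe on `Q ⋉ I_C` -/

section Schur

variable (C : Type u) [Category.{v} C] [Abelian C] [Linear ℂ C]

theorem finiteDimensional_hom [h : IsTwoVectorSpace C] (X Y : C) :
    FiniteDimensional ℂ (X ⟶ Y) := by
  obtain ⟨n, e, he⟩ := h.exists_equivalence
  have h1 := fun i => (he i).1
  have h2 := fun i => (he i).2
  have key : ∀ i, FiniteDimensional ℂ (e.functor.obj X i ⟶ e.functor.obj Y i) :=
    fun _ => inferInstance
  let φ : (X ⟶ Y) →ₗ[ℂ] (∀ i : Fin n, (e.functor.obj X i ⟶ e.functor.obj Y i)) :=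
    LinearMap.pi fun i =>
      (e.functor ⋙ Pi.eval (fun _ : Fin n => FGModuleCat.{v} ℂ) i).mapLinearMap ℂ
  have hφ : Function.Injective φ := fun f g hfg => e.functor.map_injective (funext fun i =>
    congrFun hfg i)
  exact Module.Finite.of_injective φ hφ

variable {C}

theorem finrank_hom_simple_eq_one [IsTwoVectorSpace C] {X Y : C} [Simple X] [Simple Y] (e : X ≅ Y) :
    Module.finrank ℂ (X ⟶ Y) = 1 :=
  have : FiniteDimensional ℂ (X ⟶ X) := finiteDimensional_hom C X X
  have : FiniteDimensional ℂ (X ⟶ Y) := finiteDimensional_hom C X Y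
  (finrank_hom_simple_simple_eq_one_iff ℂ X Y).2 ⟨e⟩

end Schur

/-- A bilinear pairing of two lines into a line without zero divisors induces an isomorphism from
the tensor product. -/
theorem bijective_lift_of_lines {V W U : Type*} [AddCommGroup V] [AddCommGroup W]
    [AddCommGroup U] [Module ℂ V] [Module ℂ W] [Module ℂ U] (hV : Module.finrank ℂ V = 1)
    (hW : Module.finrank ℂ W = 1) (hU : Module.finrank ℂ U = 1) (β : V →ₗ[ℂ] W →ₗ[ℂ] U)
    (hβ : ∀ x y, x ≠ 0 → y ≠ 0 → β x y ≠ 0) : Function.Bijective (TensorProduct.lift β) := by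
  have := Module.finite_of_finrank_eq_succ hV
  have := Module.finite_of_finrank_eq_succ hW
  have := Module.finite_of_finrank_eq_succ hU
  have hs : Function.Surjective (TensorProduct.lift β) := by
    have : Nontrivial V := Module.nontrivial_of_finrank_pos (R := ℂ) (by omega)
    have : Nontrivial W := Module.nontrivial_of_finrank_pos (R := ℂ) (by omega)
    obtain ⟨x, hx⟩ := exists_ne (0 : V)
    obtain ⟨y, hy⟩ := exists_ne (0 : W)
    intro z
    obtain ⟨c, hc⟩ := exists_smul_eq_of_finrank_eq_one hU (hβ x y hx hy) z
    exact ⟨c • (x ⊗ₜ[ℂ] y), by simpa using hc⟩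
  have hd : Module.finrank ℂ (TensorProduct ℂ V W) = Module.finrank ℂ U := by
    rw [Module.finrank_tensorProduct, hV, hW, hU]
  exact ⟨(LinearMap.injective_iff_surjective_of_finrank_eq_finrank hd).2 hs, hs⟩

section Gerbe

open scoped MonoidalLeftAction

variable {Q : Type w} [Group Q] {C : Type u} [Category.{v} C] [Abelian C]
  [MonoidalLeftAction (Discrete Q) C]

/-- The element `q` of `Q` labelling an arrow `i ⟶ j` of the action groupoid `Q ⋉ I_C`, so that
`q • i = j`. -/
def arrowLabel {i j : ActionCategory Q (SimpleClass C)} (f : i ⟶ j) : Discrete Q :=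
  Discrete.mk (Subtype.val f)

theorem arrowLabel_smul {i j : ActionCategory Q (SimpleClass C)} (f : i ⟶ j) :
    (arrowLabel f).as • i.back = j.back :=
  Subtype.property f

theorem arrowLabel_id (i : ActionCategory Q (SimpleClass C)) :
    arrowLabel (𝟙 i) = 𝟙_ (Discrete Q) := rfl

theorem arrowLabel_comp {i j k : ActionCategory Q (SimpleClass C)} {f : i ⟶ j} {g : j ⟶ k}
    {h : i ⟶ k} (e : f ≫ g = h) : arrowLabel g ⊗ arrowLabel f = arrowLabel h := by
  subst e; rfl

/-- The line `ℓ_{q,i} = Hom(c_j, q · c_i)` on the arrow `q : i ⟶ j = q • i`. -/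
abbrev gerbeLine (c : SimpleClass C → SimpleObject C)
    {i j : ActionCategory Q (SimpleClass C)} (f : i ⟶ j) : Type v :=
  (c j.back).obj ⟶ arrowLabel f ⊙ₗ (c i.back).obj

theorem simple_action (q : Discrete Q) (X : C) [Simple X] : Simple (q ⊙ₗ X : C) :=
  simple_obj (MonoidalLeftAction.actionLeft C q) X

theorem nonempty_gerbeLine_iso (c : SimpleClass C → SimpleObject C)
    (hc : ∀ i, SimpleClass.mk (c i) = i) {i j : ActionCategory Q (SimpleClass C)} (f : i ⟶ j) :
    Nonempty ((c j.back).obj ≅ arrowLabel f ⊙ₗ (c i.back).obj) := by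
  have h := arrowLabel_smul f
  rw [← hc i.back, ← hc j.back] at h
  obtain ⟨e⟩ := Quotient.exact h
  exact ⟨e.symm⟩

instance : IsGroupoid (ActionCategory Q (SimpleClass C)) where
  all_isIso f := (inferInstance : @IsGroupoid (ActionCategory Q (SimpleClass C)) Groupoid.toCategory).all_isIso f

variable [Linear ℂ C]

/-- The composition `ℓ_{p,j} × ℓ_{q,i} → ℓ_{pq,i}`: the pair of `b : c_k ⟶ p · c_j` and
`a : c_j ⟶ q · c_i` is sent to `c_k ⟶ p · c_j ⟶ p · (q · c_i) ≅ (pq) · c_i`. -/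
def gerbeMul [IsLinearAction Q C] (c : SimpleClass C → SimpleObject C)
    {i j k : ActionCategory Q (SimpleClass C)} {f : i ⟶ j} {g : j ⟶ k} {h : i ⟶ k}
    (e : f ≫ g = h) : gerbeLine c g →ₗ[ℂ] gerbeLine c f →ₗ[ℂ] gerbeLine c h :=
  LinearMap.mk₂ ℂ
    (fun b a => b ≫ arrowLabel g ⊴ₗ a ≫ (actionMulIso (arrowLabel_comp e) (c i.back).obj).inv)
    (by intros; simp) (by intros; simp)
    (by intros; simp [EquivariantObject.actionRight_add])
    (by intros; simp [EquivariantObject.actionRight_smul])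

/-- The unit of `ℓ_{1,i}`: the structure isomorphism `c_i ≅ 1 · c_i`. -/
def gerbeOne (c : SimpleClass C → SimpleObject C) (i : ActionCategory Q (SimpleClass C)) :
    gerbeLine c (𝟙 i) :=
  (actionOneIso (arrowLabel_id i) (c i.back).obj).inv

theorem gerbeMul_apply [IsLinearAction Q C] (c : SimpleClass C → SimpleObject C)
    {i j k : ActionCategory Q (SimpleClass C)} {f : i ⟶ j} {g : j ⟶ k} {h : i ⟶ k}
    (e : f ≫ g = h) (b : gerbeLine c g) (a : gerbeLine c f) :
    gerbeMul c e b a =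
      b ≫ arrowLabel g ⊴ₗ a ≫ (actionMulIso (arrowLabel_comp e) (c i.back).obj).inv := rfl

theorem finrank_gerbeLine [IsTwoVectorSpace C] (c : SimpleClass C → SimpleObject C)
    (hc : ∀ i, SimpleClass.mk (c i) = i) {i j : ActionCategory Q (SimpleClass C)} (f : i ⟶ j) :
    Module.finrank ℂ (gerbeLine c f) = 1 := by
  have := (c i.back).simple
  have := (c j.back).simple
  have := simple_action (arrowLabel f) (c i.back).obj
  exact finrank_hom_simple_eq_one (nonempty_gerbeLine_iso c hc f).some

theorem gerbeMul_ne_zero [IsLinearAction Q C] (c : SimpleClass C → SimpleObject C)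
    {i j k : ActionCategory Q (SimpleClass C)} {f : i ⟶ j} {g : j ⟶ k} {h : i ⟶ k}
    (e : f ≫ g = h) (b : gerbeLine c g) (a : gerbeLine c f) (hb : b ≠ 0) (ha : a ≠ 0) :
    gerbeMul c e b a ≠ 0 := by
  have := (c i.back).simple
  have := (c j.back).simple
  have := simple_action (arrowLabel f) (c i.back).obj
  have : IsIso a := isIso_of_hom_simple ha
  rw [gerbeMul_apply]
  intro h0
  exact hb ((Preadditive.IsIso.comp_right_eq_zero _ _).1 h0)

/-- The `S¹`-gerbe on the action groupoid `Q ⋉ I_C` attached to a linear action of `Q` on a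
2-vector space `C` and a choice of representatives `c_i ∈ i` of the isomorphism classes of simple
objects. Its lines are `ℓ_{q,i} = Hom(c_j, q · c_i)`, where `j = q • i`. -/
def equivariantGerbe [IsTwoVectorSpace C] [IsLinearAction Q C]
    (c : SimpleClass C → SimpleObject C) (hc : ∀ i, SimpleClass.mk (c i) = i) :
    LineGerbe.{v} (ActionCategory Q (SimpleClass C)) where
  line f := gerbeLine c f
  finrank_line f := finrank_gerbeLine c hc f
  mul e := gerbeMul c e
  mul_bijective {i j k f g h} e :=
    bijective_lift_of_lines (finrank_gerbeLine c hc g) (finrank_gerbeLine c hc f)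
      (finrank_gerbeLine c hc h) _ (gerbeMul_ne_zero c e)
  one i := gerbeOne c i
  mul_one {i j} f a := by
    have h := actionMulIso_one_right (arrowLabel_comp (Category.id_comp f)) (arrowLabel_id i) rfl
      (c i.back).obj
    rw [eqToHom_refl, ← Iso.eq_inv_comp, Category.comp_id] at h
    rw [gerbeMul_apply, gerbeOne, ← h, MonoidalLeftAction.actionHomRight_inv_hom,
      Category.comp_id]
  one_mul {i j} f a := by
    have h := actionMulIso_one_left (arrowLabel_comp (Category.comp_id f)) (arrowLabel_id j) rfl
      (c i.back).obj
    rw [eqToHom_refl, ← Iso.eq_inv_comp, Category.comp_id] at h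
    have h' := actionOneIso_naturality (arrowLabel_id j) a
    rw [← Iso.eq_inv_comp] at h'
    rw [gerbeMul_apply, gerbeOne, ← h, ← h']
  mul_assoc {i j k l f g h fg gh fgh} e₁ e₂ e₃ e₄ a b d := by
    have H := actionMulIso_assoc (arrowLabel_comp e₂) (arrowLabel_comp e₁) (arrowLabel_comp e₄)
      (arrowLabel_comp e₃) (c i.back).obj
    have N := actionMulIso_naturality (arrowLabel_comp e₂) a
    have H' := IsIso.inv_eq_inv.2 H
    simp only [IsIso.inv_comp, IsIso.Iso.inv_hom, MonoidalLeftAction.inv_actionHomRight] at H'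
    rw [← Iso.eq_inv_comp] at N
    simp only [gerbeMul_apply, Category.assoc, MonoidalLeftAction.actionHomRight_comp]
    rw [H', reassoc_of% N, Iso.hom_inv_id_assoc]

end Gerbe
end

/-! The equivalence sends an equivariant object `M` to the family of spaces `Hom(c_i, M)`, on which
`a ∈ ℓ_{q,i}` acts by `m ↦ φ_q ∘ (q · m) ∘ a`. Two facts make it work.

Semisimplicity: `X ↦ (Hom(c_i, X))_i` identifies `C` with families of finite-dimensional spaces
indexed by `I_C` (`hom_ext_of_simple`, `exists_hom_of_simple`, `exists_simpleHom_linearEquiv`).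
Under a given equivalence of `C` with a power of `Vec`, each coordinate functor is represented by an
object `coordSimple e k`. These objects are simple and form a complete irredundant list of simples
(`coordClass_bijective`), so Hom out of any representative `c_i` is a coordinate.

Translation: since `q` acts by an autoequivalence, every map `c_j ⟶ q · X` is `(q · m) ∘ a` for a
fixed nonzero `a ∈ ℓ_{q,i}` and a unique `m : c_i ⟶ X`, where `i = q⁻¹ j`
(`lineTranslate_bijective`). Thus `Hom(c_j, q · X)` is `ℓ_{q,i} ⊗ Hom(c_i, X)`, and a morphism `φ_q
: q · X ⟶ X` amounts to maps `ℓ_{q,i} ⊗ Hom(c_i, X) → Hom(c_j, X)`, one for each `j`. Testing on the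
elements `(q · m) ∘ a` turns commutation with the `φ_q` into commutation with the lines
(`exists_map_eq_of_family`), and the laws for `φ_1` and `φ_{pq}` into the unit and composition laws
of a twisted representation (`equivariantAct_one`, `equivariantAct_mul`, and conversely
`exists_equivariantObject`). -/

noncomputable section

/-! ### Coordinates on a 2-vector space -/

section Coordinates

variable {n : ℕ}

/-- The object of a finite product of copies of the category of finite-dimensional vector spaces
that is one-dimensional at `k` and zero elsewhere. -/
def piLine (k : Fin n) : Fin n → FGModuleCat.{v} ℂ := fun l =>
  -- Functions on the truth value of `l = k`: a line if it holds and zero otherwise, with no case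
  -- distinction in the type.
  FGModuleCat.of ℂ (PLift (l = k) → ULift.{v} ℂ)

/-- The generator of `piLine k` at `k`. -/
def piLineGen (k : Fin n) : (piLine.{v} k k : Type v) :=
  fun _ : PLift (k = k) => (⟨1⟩ : ULift.{v} ℂ)

theorem piLine_eq_smul_gen (k : Fin n) (x : (piLine.{v} k k : Type v)) :
    ∃ r : ℂ, x = r • piLineGen.{v} k := by
  refine ⟨((x : PLift (k = k) → ULift.{v} ℂ) ⟨rfl⟩).down, ?_⟩
  funext h
  apply ULift.ext
  change _ = _ * (1 : ℂ)
  rw [_root_.mul_one]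

theorem piLineGen_ne_zero (k : Fin n) : piLineGen.{v} k ≠ 0 := fun h =>
  one_ne_zero (congrArg ULift.down (congrFun h ⟨rfl⟩))

theorem piLine_subsingleton {k l : Fin n} (h : l ≠ k) :
    Subsingleton (piLine.{v} k l : Type v) :=
  ⟨fun _ _ => funext fun h' => (h h'.down).elim⟩

/-- `piLine k` represents the evaluation at `k`. -/
theorem piLine_bijective (k : Fin n) (Z : Fin n → FGModuleCat.{v} ℂ) :
    Function.Bijective fun g : piLine.{v} k ⟶ Z => (g k).hom.hom (piLineGen k) := by
  constructor
  · intro f g h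
    funext l
    apply FGModuleCat.hom_ext
    ext x
    by_cases hl : l = k
    · subst hl
      obtain ⟨r, rfl⟩ := piLine_eq_smul_gen l x
      rw [map_smul, map_smul]
      exact congrArg (r • ·) h
    · have := piLine_subsingleton hl
      obtain rfl : x = 0 := Subsingleton.elim _ _
      rw [map_zero, map_zero]
  · intro z
    -- Send the generator at `k` to `z`; away from `k` the source is zero, so the default value 0
    -- loses nothing.
    let φ : ∀ l, (PLift (l = k) → ULift.{v} ℂ) →ₗ[ℂ] (Z l : Type v) := fun l =>
      if h : l = k then
        (LinearMap.toSpanSingleton ℂ (Z l : Type v) (h ▸ z)) ∘ₗ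
          ULift.moduleEquiv.toLinearMap ∘ₗ LinearMap.proj (⟨h⟩ : PLift (l = k))
      else 0
    refine ⟨fun l => FGModuleCat.ofHom (φ l), ?_⟩
    change φ k (piLineGen k) = z
    have : φ k = (LinearMap.toSpanSingleton ℂ (Z k : Type v) z) ∘ₗ
          ULift.moduleEquiv.toLinearMap ∘ₗ LinearMap.proj (⟨rfl⟩ : PLift (k = k)) := dif_pos rfl
    rw [this]
    exact one_smul ℂ z

variable {C : Type u} [Category.{v} C] (e : C ≌ (Fin n → FGModuleCat.{v} ℂ))

/-- The linear map induced by a morphism on the `k`-th coordinate. -/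
def coordMap (k : Fin n) {X Y : C} (f : X ⟶ Y) :
    (e.functor.obj X k : Type v) →ₗ[ℂ] (e.functor.obj Y k : Type v) :=
  (e.functor.map f k).hom.hom

@[simp] theorem coordMap_id (k : Fin n) (X : C) : coordMap e k (𝟙 X) = LinearMap.id := by
  rw [coordMap, e.functor.map_id]
  rfl

theorem coordMap_comp (k : Fin n) {X Y Z : C} (f : X ⟶ Y) (g : Y ⟶ Z) :
    coordMap e k (f ≫ g) = coordMap e k g ∘ₗ coordMap e k f := by
  rw [coordMap, e.functor.map_comp]
  rfl

@[simp] theorem coordMap_comp_apply (k : Fin n) {X Y Z : C} (f : X ⟶ Y) (g : Y ⟶ Z)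
    (x : (e.functor.obj X k : Type v)) :
    coordMap e k (f ≫ g) x = coordMap e k g (coordMap e k f x) := by
  rw [coordMap_comp]
  rfl

theorem coordMap_ext {X Y : C} {f g : X ⟶ Y} (h : ∀ k, coordMap e k f = coordMap e k g) :
    f = g :=
  e.functor.map_injective (funext fun k => FGModuleCat.hom_ext (h k))

theorem exists_coordMap_eq {X Y : C}
    (φ : ∀ k, (e.functor.obj X k : Type v) →ₗ[ℂ] (e.functor.obj Y k : Type v)) :
    ∃ f : X ⟶ Y, ∀ k, coordMap e k f = φ k := by
  refine ⟨e.functor.preimage fun k => FGModuleCat.ofHom (φ k), fun k => ?_⟩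
  rw [coordMap, e.functor.map_preimage]
  rfl

theorem isIso_of_bijective_coordMap {X Y : C} (f : X ⟶ Y)
    (h : ∀ k, Function.Bijective (coordMap e k f)) : IsIso f := by
  obtain ⟨g, hg⟩ := exists_coordMap_eq e
    (fun k => (LinearEquiv.ofBijective (coordMap e k f) (h k)).symm.toLinearMap)
  refine ⟨g, coordMap_ext e fun k => ?_, coordMap_ext e fun k => ?_⟩
  · rw [coordMap_comp, hg, coordMap_id]
    ext x
    exact (LinearEquiv.ofBijective (coordMap e k f) (h k)).symm_apply_apply x
  · rw [coordMap_comp, hg, coordMap_id]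
    ext x
    exact (LinearEquiv.ofBijective (coordMap e k f) (h k)).apply_symm_apply x

theorem exists_coord_linearEquiv (M : Fin n → Type v) [∀ k, AddCommGroup (M k)]
    [∀ k, Module ℂ (M k)] [∀ k, Module.Finite ℂ (M k)] :
    ∃ X : C, ∀ k, Nonempty ((e.functor.obj X k : Type v) ≃ₗ[ℂ] M k) :=
  ⟨e.inverse.obj fun k => FGModuleCat.of ℂ (M k), fun k =>
    ⟨FGModuleCat.isoToLinearEquiv (Pi.isoApp (e.counitIso.app _) k)⟩⟩

/-- The object of `C` corresponding to `piLine k`. -/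
def coordSimple (k : Fin n) : C := e.inverse.obj (piLine.{v} k)

/-- The universal element of the `k`-th coordinate of `coordSimple e k`. -/
def coordGen (k : Fin n) : (e.functor.obj (coordSimple e k) k : Type v) :=
  ((e.counitIso.inv.app (piLine.{v} k)) k).hom.hom (piLineGen k)

/-- `coordSimple e k` represents the `k`-th coordinate. -/
theorem coordGen_bijective (k : Fin n) (X : C) :
    Function.Bijective fun g : coordSimple e k ⟶ X => coordMap e k g (coordGen e k) :=
  (piLine_bijective k (e.functor.obj X)).comp
    (((e.counitIso.app (piLine.{v} k)).symm.homFromEquiv.symm.bijective).comp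
      (e.fullyFaithfulFunctor.homEquiv (X := coordSimple e k) (Y := X)).bijective)

/-- The coordinates of `coordSimple e k`. -/
def coordSimpleEquiv (k l : Fin n) :
    (e.functor.obj (coordSimple e k) l : Type v) ≃ₗ[ℂ] (piLine.{v} k l : Type v) :=
  FGModuleCat.isoToLinearEquiv (Pi.isoApp (e.counitIso.app (piLine.{v} k)) l)

theorem coordSimpleEquiv_symm_gen (k : Fin n) :
    (coordSimpleEquiv e k k).symm (piLineGen k) = coordGen e k := rfl

theorem coord_coordSimple_subsingleton {k l : Fin n} (h : l ≠ k) :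
    Subsingleton (e.functor.obj (coordSimple e k) l : Type v) :=
  have := piLine_subsingleton.{v} h
  (coordSimpleEquiv e k l).toEquiv.subsingleton

theorem coord_coordSimple_eq_smul (k : Fin n) (x : (e.functor.obj (coordSimple e k) k : Type v)) :
    ∃ r : ℂ, x = r • coordGen e k := by
  obtain ⟨r, hr⟩ := piLine_eq_smul_gen k (coordSimpleEquiv e k k x)
  refine ⟨r, ?_⟩
  rw [← coordSimpleEquiv_symm_gen, ← map_smul, ← hr, LinearEquiv.symm_apply_apply]

theorem coordGen_ne_zero (k : Fin n) : coordGen e k ≠ 0 := by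
  rw [← coordSimpleEquiv_symm_gen]
  exact (coordSimpleEquiv e k k).symm.map_ne_zero_iff.2 (piLineGen_ne_zero k)

/-- Monomorphisms are injective on coordinates. -/
theorem coordMap_injective_of_mono (k : Fin n) {X Y : C} (f : X ⟶ Y) [Mono f] :
    Function.Injective (coordMap e k f) := by
  intro x y h
  obtain ⟨g, rfl⟩ := (coordGen_bijective e k X).2 x
  obtain ⟨g', rfl⟩ := (coordGen_bijective e k X).2 y
  have : g ≫ f = g' ≫ f := (coordGen_bijective e k Y).1 (by simpa using h)
  rw [(cancel_mono f).1 this]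

section Linear

variable [Preadditive C] [Linear ℂ C]

/-- Linearity of the coordinates of `C`. -/
def CoordLinear : Prop :=
  ∀ i : Fin n,
    (e.functor ⋙ Pi.eval (fun _ : Fin n => FGModuleCat.{v} ℂ) i).Additive ∧
    (e.functor ⋙ Pi.eval (fun _ : Fin n => FGModuleCat.{v} ℂ) i).Linear ℂ

variable {e}

theorem coordMap_add (he : CoordLinear e) (k : Fin n) {X Y : C} (f g : X ⟶ Y) :
    coordMap e k (f + g) = coordMap e k f + coordMap e k g := by
  have := (he k).1
  exact congrArg (fun φ => φ.hom.hom)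
    ((e.functor ⋙ Pi.eval (fun _ : Fin n => FGModuleCat.{v} ℂ) k).map_add (f := f) (g := g))

theorem coordMap_smul (he : CoordLinear e) (k : Fin n) {X Y : C} (r : ℂ) (f : X ⟶ Y) :
    coordMap e k (r • f) = r • coordMap e k f := by
  have := (he k).2
  exact congrArg (fun φ => φ.hom.hom)
    (Functor.Linear.map_smul (F := e.functor ⋙ Pi.eval (fun _ : Fin n => FGModuleCat.{v} ℂ) k) f r)

theorem coordMap_zero (he : CoordLinear e) (k : Fin n) (X Y : C) :
    coordMap e k (0 : X ⟶ Y) = 0 := by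
  have := coordMap_smul he k (0 : ℂ) (0 : X ⟶ Y)
  rwa [zero_smul, zero_smul] at this

/-- A monomorphism is injective on coordinates, and the target is a line at `k` and zero elsewhere.
A nonzero mono therefore hits a nonzero vector of that line, is bijective on every coordinate, and
is an isomorphism. -/
theorem simple_coordSimple (he : CoordLinear e) (k : Fin n) : Simple (coordSimple e k) where
  mono_isIso_iff_nonzero {Y} f hf := by
    constructor
    · rintro h rfl
      have h1 : 𝟙 (coordSimple e k) = 0 := by
        rw [← IsIso.inv_hom_id (0 : Y ⟶ coordSimple e k), Limits.comp_zero]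
      have h2 := coordMap_id e k (coordSimple e k)
      rw [h1, coordMap_zero he] at h2
      exact coordGen_ne_zero e k (LinearMap.congr_fun h2 (coordGen e k)).symm
    · intro h
      refine isIso_of_bijective_coordMap e f fun l => ⟨coordMap_injective_of_mono e l f, ?_⟩
      by_cases hl : l = k
      · subst hl
        -- The coordinates other than `l` have zero target, so a nonzero `f` must be nonzero on the
        -- `l`-th one.
        obtain ⟨y, hy⟩ : ∃ y, coordMap e l f y ≠ 0 := by
          by_contra! hc
          refine h (coordMap_ext e fun m => ?_)
          rw [coordMap_zero he]
          by_cases hm : m = l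
          · subst hm
            exact LinearMap.ext hc
          · have := coord_coordSimple_subsingleton e hm
            exact LinearMap.ext fun _ => Subsingleton.elim _ _
        intro x
        obtain ⟨r, hr⟩ := coord_coordSimple_eq_smul e l (coordMap e l f y)
        obtain ⟨s, rfl⟩ := coord_coordSimple_eq_smul e l x
        have hr0 : r ≠ 0 := by
          rintro rfl
          exact hy (by rw [hr, zero_smul])
        exact ⟨(s / r) • y, by rw [map_smul, hr, smul_smul, div_mul_cancel₀ s hr0]⟩
      · have := coord_coordSimple_subsingleton e hl
        exact fun x => ⟨0, Subsingleton.elim _ _⟩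

end Linear

/-! ### Classification of the simple objects by coordinates -/

section Classification

variable {C : Type u} [Category.{v} C] [Abelian C] [Linear ℂ C]
  {e : C ≌ (Fin n → FGModuleCat.{v} ℂ)}

/-- Some coordinate of `X` is nonzero, since otherwise the identity of `X` would vanish. By
representability a nonzero vector there is a nonzero map from a simple object to `X`, and Schur's
lemma applies. -/
theorem exists_iso_coordSimple (he : CoordLinear e) (X : C) [Simple X] :
    ∃ k, Nonempty (coordSimple e k ≅ X) := by
  obtain ⟨k, x, hx⟩ : ∃ k, ∃ x : (e.functor.obj X k : Type v), x ≠ 0 := by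
    by_contra! hc
    exact id_nonzero X (coordMap_ext e fun k => LinearMap.ext fun x => by
      rw [hc k x, map_zero, map_zero])
  obtain ⟨g, rfl⟩ := (coordGen_bijective e k X).2 x
  have hg : g ≠ 0 := by
    rintro rfl
    exact hx (by simp [coordMap_zero he])
  have := simple_coordSimple he k
  have := isIso_of_hom_simple hg
  exact ⟨k, ⟨asIso g⟩⟩

/-- The isomorphism class of the `k`-th simple object. -/
def coordClass (he : CoordLinear e) (k : Fin n) : SimpleClass C :=
  SimpleClass.mk ⟨coordSimple e k, simple_coordSimple he k⟩

theorem coordClass_bijective (he : CoordLinear e) : Function.Bijective (coordClass he) := by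
  constructor
  · intro k l h
    obtain ⟨f⟩ := Quotient.exact h
    by_contra hkl
    change coordSimple e k ≅ coordSimple e l at f
    have := coord_coordSimple_subsingleton e hkl
    -- The identity factors through `coordSimple e l`, whose `k`-th coordinate is zero.
    have h0 : coordMap e k (𝟙 (coordSimple e k)) (coordGen e k) = 0 := by
      rw [← f.hom_inv_id, coordMap_comp_apply,
        Subsingleton.elim (coordMap e k f.hom (coordGen e k)) 0, map_zero]
    rw [coordMap_id] at h0
    exact coordGen_ne_zero e k h0
  · intro i
    induction i using Quotient.inductionOn with | _ X =>
    have := X.simple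
    obtain ⟨k, ⟨f⟩⟩ := exists_iso_coordSimple he X.obj
    exact ⟨k, Quotient.sound ⟨f⟩⟩

/-- Any simple object in the `k`-th class represents the `k`-th coordinate. -/
theorem exists_coord_linearEquiv_hom (he : CoordLinear e) (k : Fin n) (S : SimpleObject C)
    (hS : SimpleClass.mk S = coordClass he k) :
    ∃ E : ∀ X : C, (S.obj ⟶ X) ≃ₗ[ℂ] (e.functor.obj X k : Type v),
      ∀ (X Y : C) (f : X ⟶ Y) (g : S.obj ⟶ X), E Y (g ≫ f) = coordMap e k f (E X g) := by
  obtain ⟨a⟩ := Quotient.exact hS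
  change S.obj ≅ coordSimple e k at a
  -- The universal element, carried over to `S` along the isomorphism `a`.
  let u := coordMap e k a.inv (coordGen e k)
  have hb : ∀ X : C, Function.Bijective fun g : S.obj ⟶ X => coordMap e k g u := by
    intro X
    have := (coordGen_bijective e k X).comp a.homFromEquiv.bijective
    convert this using 2 with g
    simp [u]
  exact ⟨fun X => LinearEquiv.ofBijective
    { toFun := fun g => coordMap e k g u
      map_add' := fun g g' => by rw [coordMap_add he]; rfl
      map_smul' := fun r g => by rw [coordMap_smul he]; rfl } (hb X),
    fun X Y f g => coordMap_comp_apply e k g f u⟩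

end Classification

end Coordinates

/-! ### The functors `Hom(c_i, -)` as coordinates on `C` -/

section SimpleHom

variable {C : Type u} [Category.{v} C] [Abelian C] [Linear ℂ C] [IsTwoVectorSpace C]
  {c : SimpleClass C → SimpleObject C}

/-- The functors `Hom(c_i, -)` are jointly faithful. -/
theorem hom_ext_of_simple (hc : ∀ i, SimpleClass.mk (c i) = i) {X Y : C} {f g : X ⟶ Y}
    (h : ∀ i (x : (c i).obj ⟶ X), x ≫ f = x ≫ g) : f = g := by
  obtain ⟨n, e, he⟩ := IsTwoVectorSpace.exists_equivalence (C := C)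
  refine coordMap_ext e fun k => LinearMap.ext fun x => ?_
  obtain ⟨E, hE⟩ := exists_coord_linearEquiv_hom he k (c (coordClass he k)) (hc _)
  obtain ⟨x, rfl⟩ := (E X).surjective x
  rw [← hE, ← hE, h]

/-- The functors `Hom(c_i, -)` are jointly full. -/
theorem exists_hom_of_simple (hc : ∀ i, SimpleClass.mk (c i) = i) {X Y : C}
    (T : ∀ i, ((c i).obj ⟶ X) →ₗ[ℂ] ((c i).obj ⟶ Y)) :
    ∃ f : X ⟶ Y, ∀ i (x : (c i).obj ⟶ X), x ≫ f = T i x := by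
  obtain ⟨n, e, he⟩ := IsTwoVectorSpace.exists_equivalence (C := C)
  choose E hE using fun k => exists_coord_linearEquiv_hom he k (c (coordClass he k)) (hc _)
  obtain ⟨f, hf⟩ := exists_coordMap_eq e
    (fun k => (E k Y).toLinearMap ∘ₗ T (coordClass he k) ∘ₗ (E k X).symm.toLinearMap)
  refine ⟨f, fun i x => ?_⟩
  obtain ⟨k, rfl⟩ := (coordClass_bijective he).2 i
  apply (E k Y).injective
  simp [hE, hf]

/-- Families of finite-dimensional spaces indexed by `I_C` come from objects of `C`. -/
theorem exists_simpleHom_linearEquiv (hc : ∀ i, SimpleClass.mk (c i) = i)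
    (M : SimpleClass C → Type v) [∀ i, AddCommGroup (M i)] [∀ i, Module ℂ (M i)]
    [∀ i, Module.Finite ℂ (M i)] :
    ∃ X : C, ∀ i, Nonempty (((c i).obj ⟶ X) ≃ₗ[ℂ] M i) := by
  obtain ⟨n, e, he⟩ := IsTwoVectorSpace.exists_equivalence (C := C)
  obtain ⟨X, hX⟩ := exists_coord_linearEquiv e fun k => M (coordClass he k)
  refine ⟨X, fun i => ?_⟩
  obtain ⟨k, rfl⟩ := (coordClass_bijective he).2 i
  obtain ⟨E, -⟩ := exists_coord_linearEquiv_hom he k (c (coordClass he k)) (hc _)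
  exact ⟨E X ≪≫ₗ (hX k).some⟩

/-- Joint fullness realizes the inverse bijections by a morphism `g`; joint faithfulness shows that
`g` is inverse to `f`. -/
theorem isIso_of_simple (hc : ∀ i, SimpleClass.mk (c i) = i) {X Y : C} (f : X ⟶ Y)
    (h : ∀ i, Function.Bijective fun x : (c i).obj ⟶ X => x ≫ f) : IsIso f := by
  have hc' : ∀ i, Function.Bijective (Linear.rightComp ℂ (c i).obj f) := h
  obtain ⟨g, hg⟩ := exists_hom_of_simple hc
    (fun i => (LinearEquiv.ofBijective (Linear.rightComp ℂ (c i).obj f) (hc' i)).symm.toLinearMap)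
  refine ⟨g, hom_ext_of_simple hc fun i x => ?_, hom_ext_of_simple hc fun i x => ?_⟩
  · rw [← Category.assoc, hg, Category.comp_id]
    exact (LinearEquiv.ofBijective (Linear.rightComp ℂ (c i).obj f) (hc' i)).symm_apply_apply x
  · rw [← Category.assoc, hg, Category.comp_id]
    exact (LinearEquiv.ofBijective (Linear.rightComp ℂ (c i).obj f) (hc' i)).apply_symm_apply x

end SimpleHom

/-! ### Generalities on twisted representations -/

namespace TwistedRep

variable {G : Type u} [Category.{v} G] [IsGroupoid G] {L : LineGerbe.{w} G}

/-- Since `ℓ_f` is spanned by `a`, every tensor in `ℓ_g ⊗ ℓ_f` is pure with second factor `a`.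
Together with the mirror statement below, this makes nonzero elements of the lines invertible on
either side. -/
theorem _root_.LineGerbe.exists_mul_eq {i j k : G} {f : i ⟶ j} {g : j ⟶ k} {h : i ⟶ k}
    (e : f ≫ g = h) {a : L.line f} (ha : a ≠ 0) (z : L.line h) : ∃ b, L.mul e b a = z := by
  obtain ⟨t, rfl⟩ := (L.mul_bijective e).2 z
  suffices ∃ b, t = b ⊗ₜ[ℂ] a by
    obtain ⟨b, rfl⟩ := this
    exact ⟨b, (TensorProduct.lift.tmul _ _).symm⟩
  induction t with
  | zero => exact ⟨0, (TensorProduct.zero_tmul _ _).symm⟩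
  | tmul x y =>
    obtain ⟨r, rfl⟩ := exists_smul_eq_of_finrank_eq_one (L.finrank_line f) ha y
    exact ⟨r • x, (TensorProduct.smul_tmul _ _ _).symm⟩
  | add x y hx hy =>
    obtain ⟨b, rfl⟩ := hx
    obtain ⟨b', rfl⟩ := hy
    exact ⟨b + b', (TensorProduct.add_tmul _ _ _).symm⟩

theorem _root_.LineGerbe.exists_eq_mul {i j k : G} {f : i ⟶ j} {g : j ⟶ k} {h : i ⟶ k}
    (e : f ≫ g = h) {b : L.line g} (hb : b ≠ 0) (z : L.line h) : ∃ a, L.mul e b a = z := by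
  obtain ⟨t, rfl⟩ := (L.mul_bijective e).2 z
  suffices ∃ a, t = b ⊗ₜ[ℂ] a by
    obtain ⟨a, rfl⟩ := this
    exact ⟨a, (TensorProduct.lift.tmul _ _).symm⟩
  induction t with
  | zero => exact ⟨0, (TensorProduct.tmul_zero _ _).symm⟩
  | tmul x y =>
    obtain ⟨r, rfl⟩ := exists_smul_eq_of_finrank_eq_one (L.finrank_line g) hb x
    exact ⟨r • y, TensorProduct.smul_tmul _ _ _⟩
  | add x y hx hy =>
    obtain ⟨a, rfl⟩ := hx
    obtain ⟨a', rfl⟩ := hy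
    exact ⟨a + a', (TensorProduct.tmul_add _ _ _).symm⟩

/-- Nonzero elements of the lines act by isomorphisms. -/
theorem act_bijective (W : TwistedRep.{w'} L) {i j : G} (f : i ⟶ j) {a : L.line f} (ha : a ≠ 0) :
    Function.Bijective (W.act f a) := by
  obtain ⟨b, hb⟩ := LineGerbe.exists_mul_eq (IsIso.hom_inv_id f) ha (L.one i)
  obtain ⟨b', hb'⟩ := LineGerbe.exists_eq_mul (IsIso.inv_hom_id f) ha (L.one j)
  refine Function.bijective_iff_has_inverse.2 ⟨W.act (inv f) b, fun x => ?_, fun y => ?_⟩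
  · rw [← W.mul_act (IsIso.hom_inv_id f), hb, W.one_act]
  -- The left inverse `b` and the right inverse `b'` of `a` are found independently; their actions
  -- agree by the usual monoid argument.
  · have h : Function.LeftInverse (W.act f a) (W.act (inv f) b') := fun y => by
      rw [← W.mul_act (IsIso.inv_hom_id f), hb', W.one_act]
    have h' : Function.LeftInverse (W.act (inv f) b) (W.act f a) := fun x => by
      rw [← W.mul_act (IsIso.hom_inv_id f), hb, W.one_act]
    rw [← h y, h']

/-- An isomorphism of twisted representations from a family of linear equivalences. -/
def isoOfLinearEquiv {V W : TwistedRep.{w'} L} (ψ : ∀ i, V.space i ≃ₗ[ℂ] W.space i)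
    (h : ∀ {i j : G} (f : i ⟶ j) (a : L.line f) (m : V.space i),
      ψ j (V.act f a m) = W.act f a (ψ i m)) : V ≅ W where
  hom := ⟨fun i => (ψ i).toLinearMap, h⟩
  inv := ⟨fun i => (ψ i).symm.toLinearMap, fun {i j} f a m => by
    simp only [LinearEquiv.coe_coe]
    rw [LinearEquiv.symm_apply_eq, h, LinearEquiv.apply_symm_apply]⟩
  hom_inv_id := Hom.ext (funext fun i => LinearMap.ext fun x => (ψ i).symm_apply_apply x)
  inv_hom_id := Hom.ext (funext fun i => LinearMap.ext fun x => (ψ i).apply_symm_apply x)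

end TwistedRep

/-! ### The twisted representation of an equivariant object -/

section Comparison

open scoped MonoidalLeftAction

variable {Q : Type w} [Group Q] {C : Type u} [Category.{v} C]

namespace EquivariantObject

variable [MonoidalLeftAction (Discrete Q) C] (M : EquivariantObject Q C)

/-- The equivariance axioms, here and in the next lemma, for a label only propositionally equal to
`1` or `pq`, so that they apply directly to labels of arrows. -/
theorem iso_eq_actionOneIso {r : Discrete Q} (h : r = 𝟙_ (Discrete Q)) :
    (M.iso r).hom = (actionOneIso h M.obj).hom := by
  subst h
  simp [actionOneIso, M.iso_unit]

theorem iso_eq_actionMulIso {p q r : Discrete Q} (h : p ⊗ q = r) :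
    (M.iso r).hom = (actionMulIso h M.obj).hom ≫ p ⊴ₗ (M.iso q).hom ≫ (M.iso p).hom := by
  subst h
  simp [actionMulIso, M.iso_mul]

end EquivariantObject

variable [Abelian C] [MonoidalLeftAction (Discrete Q) C] {c : SimpleClass C → SimpleObject C}

theorem exists_arrowLabel_eq (q : Discrete Q) (j : ActionCategory Q (SimpleClass C)) :
    ∃ (i : ActionCategory Q (SimpleClass C)) (f : i ⟶ j), arrowLabel f = q :=
  ⟨((q.as⁻¹ • j.back : SimpleClass C) : ActionCategory Q (SimpleClass C)),
    ⟨q.as, smul_inv_smul q.as j.back⟩, rfl⟩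

/-- The label `q` and the target `j` force the source to be `q⁻¹ j`. Equality in the sigma type
allows source and arrow to be substituted together. -/
theorem arrow_ext {i i' j : ActionCategory Q (SimpleClass C)} {f : i ⟶ j} {f' : i' ⟶ j}
    (h : arrowLabel f = arrowLabel f') :
    (⟨i, f⟩ : Σ i : ActionCategory Q (SimpleClass C), i ⟶ j) = ⟨i', f'⟩ := by
  have h1 := arrowLabel_smul f
  rw [h, ← arrowLabel_smul f'] at h1
  have h2 : i = i' :=
    congrArg (ActionCategory.objEquiv Q (SimpleClass C)) (smul_left_cancel (arrowLabel f').as h1)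
  subst h2
  congr 1
  exact Subtype.ext (congrArg Discrete.as h)

/-! ### The coordinates `Hom(c_i, -)` indexed by the objects of the action groupoid -/

section Objects

variable [Linear ℂ C] [IsTwoVectorSpace C]

theorem hom_ext_of_object (hc : ∀ i, SimpleClass.mk (c i) = i) {X Y : C} {f g : X ⟶ Y}
    (h : ∀ (i : ActionCategory Q (SimpleClass C)) (x : (c i.back).obj ⟶ X), x ≫ f = x ≫ g) :
    f = g :=
  hom_ext_of_simple hc fun i x => h (ActionCategory.objEquiv Q (SimpleClass C) i) x

theorem exists_hom_of_object (hc : ∀ i, SimpleClass.mk (c i) = i) {X Y : C}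
    (T : ∀ i : ActionCategory Q (SimpleClass C),
      ((c i.back).obj ⟶ X) →ₗ[ℂ] ((c i.back).obj ⟶ Y)) :
    ∃ f : X ⟶ Y, ∀ (i : ActionCategory Q (SimpleClass C)) (x : (c i.back).obj ⟶ X),
      x ≫ f = T i x := by
  obtain ⟨f, hf⟩ := exists_hom_of_simple hc
    fun i => T (ActionCategory.objEquiv Q (SimpleClass C) i)
  exact ⟨f, fun i x => hf i.back x⟩

theorem isIso_of_object (hc : ∀ i, SimpleClass.mk (c i) = i) {X Y : C} (f : X ⟶ Y)
    (h : ∀ i : ActionCategory Q (SimpleClass C),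
      Function.Bijective fun x : (c i.back).obj ⟶ X => x ≫ f) : IsIso f :=
  isIso_of_simple hc f fun i => h (ActionCategory.objEquiv Q (SimpleClass C) i)

theorem exists_objectHom_linearEquiv (hc : ∀ i, SimpleClass.mk (c i) = i)
    (M : ActionCategory Q (SimpleClass C) → Type v) [h₁ : ∀ i, AddCommGroup (M i)]
    [h₂ : ∀ i, Module ℂ (M i)] [h₃ : ∀ i, Module.Finite ℂ (M i)] :
    ∃ X : C, ∀ i : ActionCategory Q (SimpleClass C),
      Nonempty (((c i.back).obj ⟶ X) ≃ₗ[ℂ] M i) := by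
  let E := ActionCategory.objEquiv Q (SimpleClass C)
  obtain ⟨X, hX⟩ := @exists_simpleHom_linearEquiv C _ _ _ _ c hc (fun i => M (E i))
    (fun i => h₁ (E i)) (fun i => h₂ (E i)) (fun i => h₃ (E i))
  exact ⟨X, fun i => hX i.back⟩

end Objects

variable [Linear ℂ C] [IsLinearAction Q C]

/-- The linear map `Hom(c_i, X) → Hom(c_j, q · X)`, `m ↦ (q · m) ∘ a`. -/
def lineTranslate {i j : ActionCategory Q (SimpleClass C)} (f : i ⟶ j) (X : C) :
    gerbeLine c f →ₗ[ℂ] ((c i.back).obj ⟶ X) →ₗ[ℂ] ((c j.back).obj ⟶ arrowLabel f ⊙ₗ X) :=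
  LinearMap.mk₂ ℂ (fun a m => a ≫ arrowLabel f ⊴ₗ m)
    (by intros; simp) (by intros; simp)
    (by intros; simp [EquivariantObject.actionRight_add])
    (by intros; simp [EquivariantObject.actionRight_smul])

@[simp] theorem lineTranslate_apply {i j : ActionCategory Q (SimpleClass C)} (f : i ⟶ j) (X : C)
    (a : gerbeLine c f) (m : (c i.back).obj ⟶ X) :
    lineTranslate f X a m = a ≫ arrowLabel f ⊴ₗ m := rfl

/-- The functor `q · -` is fully faithful, and precomposition with the isomorphism `a` is bijective.
-/
theorem lineTranslate_bijective {i j : ActionCategory Q (SimpleClass C)} (f : i ⟶ j) (X : C)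
    (a : gerbeLine c f) [IsIso a] : Function.Bijective (lineTranslate f X a) := by
  have h1 : Function.Bijective fun m : (c i.back).obj ⟶ X => arrowLabel f ⊴ₗ m :=
    ⟨(MonoidalLeftAction.actionLeft C (arrowLabel f)).map_injective,
      (MonoidalLeftAction.actionLeft C (arrowLabel f)).map_surjective⟩
  exact (asIso a).symm.homFromEquiv.bijective.comp h1

/-- The action `a ⊗ m ↦ φ_q ∘ (q · m) ∘ a` of the lines on the spaces `Hom(c_i, M)`. -/
def equivariantAct (M : EquivariantObject Q C) {i j : ActionCategory Q (SimpleClass C)}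
    (f : i ⟶ j) :
    gerbeLine c f →ₗ[ℂ] ((c i.back).obj ⟶ M.obj) →ₗ[ℂ] ((c j.back).obj ⟶ M.obj) :=
  (lineTranslate f M.obj).compr₂ (Linear.rightComp ℂ _ (M.iso (arrowLabel f)).hom)

theorem equivariantAct_apply (M : EquivariantObject Q C)
    {i j : ActionCategory Q (SimpleClass C)} (f : i ⟶ j) (a : gerbeLine c f)
    (m : (c i.back).obj ⟶ M.obj) :
    equivariantAct M f a m = a ≫ arrowLabel f ⊴ₗ m ≫ (M.iso (arrowLabel f)).hom :=
  Category.assoc _ _ _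

/-- By naturality in `m`, the structure isomorphism `(pq) · X ≅ p · (q · X)` cancels its inverse in
the composition of the gerbe. Both composition laws, for equivariant objects and for the converse
construction, rest on this. -/
theorem gerbeMul_comp {i j k : ActionCategory Q (SimpleClass C)} {f : i ⟶ j} {g : j ⟶ k}
    {h : i ⟶ k} (e : f ≫ g = h) (b : gerbeLine c g) (a : gerbeLine c f) {X : C}
    (m : (c i.back).obj ⟶ X) :
    gerbeMul c e b a ≫ arrowLabel h ⊴ₗ m ≫ (actionMulIso (arrowLabel_comp e) X).hom =
      b ≫ arrowLabel g ⊴ₗ (a ≫ arrowLabel f ⊴ₗ m) := by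
  rw [gerbeMul_apply, ← actionMulIso_naturality]
  simp

theorem equivariantAct_one (M : EquivariantObject Q C) (i : ActionCategory Q (SimpleClass C))
    (m : (c i.back).obj ⟶ M.obj) : equivariantAct M (𝟙 i) (gerbeOne c i) m = m := by
  rw [equivariantAct_apply, gerbeOne, M.iso_eq_actionOneIso (arrowLabel_id i),
    ← actionOneIso_naturality, Iso.inv_hom_id_assoc]

theorem equivariantAct_mul (M : EquivariantObject Q C)
    {i j k : ActionCategory Q (SimpleClass C)} {f : i ⟶ j} {g : j ⟶ k} {h : i ⟶ k}
    (e : f ≫ g = h) (b : gerbeLine c g) (a : gerbeLine c f) (m : (c i.back).obj ⟶ M.obj) :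
    equivariantAct M h (gerbeMul c e b a) m = equivariantAct M g b (equivariantAct M f a m) := by
  -- Follow `gerbeMul_comp` by `φ_p ∘ (p · φ_q)`; on the left this assembles `φ_{pq}`.
  have h' := congrArg (· ≫ arrowLabel g ⊴ₗ (M.iso (arrowLabel f)).hom ≫
    (M.iso (arrowLabel g)).hom) (gerbeMul_comp e b a m)
  rw [equivariantAct_apply, equivariantAct_apply, equivariantAct_apply,
    M.iso_eq_actionMulIso (arrowLabel_comp e)]
  simpa using h'

theorem equivariantAct_comp {M N : EquivariantObject Q C} (φ : M ⟶ N)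
    {i j : ActionCategory Q (SimpleClass C)} (f : i ⟶ j) (a : gerbeLine c f)
    (m : (c i.back).obj ⟶ M.obj) :
    equivariantAct M f a m ≫ φ.hom = equivariantAct N f a (m ≫ φ.hom) := by
  rw [equivariantAct_apply, equivariantAct_apply]
  simp [φ.comm]

variable [IsTwoVectorSpace C]

/-- The twisted representation `i ↦ Hom(c_i, M)` attached to an equivariant object `M`. -/
def toTwistedRep (hc : ∀ i, SimpleClass.mk (c i) = i) (M : EquivariantObject Q C) :
    TwistedRep.{v} (equivariantGerbe (Q := Q) c hc) where
  space i := (c i.back).obj ⟶ M.obj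
  finite _ := finiteDimensional_hom C _ _
  act f := equivariantAct M f
  one_act i m := equivariantAct_one M i m
  mul_act e b a m := equivariantAct_mul M e b a m

/-- The functor `M ↦ (Hom(c_i, M))_i` from equivariant objects to twisted representations. -/
def twistedRepFunctor (hc : ∀ i, SimpleClass.mk (c i) = i) :
    EquivariantObject Q C ⥤ TwistedRep.{v} (equivariantGerbe (Q := Q) c hc) where
  obj M := toTwistedRep hc M
  map φ :=
    { hom := fun i => Linear.rightComp ℂ (c i.back).obj φ.hom
      comm := fun f a m => equivariantAct_comp φ f a m }
  map_id _ := TwistedRep.Hom.ext (funext fun _ => LinearMap.ext fun _ => Category.comp_id _)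
  map_comp _ _ := TwistedRep.Hom.ext (funext fun _ => LinearMap.ext fun _ =>
    (Category.assoc _ _ _).symm)

/-! ### Linearity, faithfulness and fullness -/

variable (hc : ∀ i, SimpleClass.mk (c i) = i)

instance : (twistedRepFunctor (Q := Q) hc).Additive where
  map_add := TwistedRep.Hom.ext (funext fun _ => LinearMap.ext fun _ =>
    Preadditive.comp_add _ _ _ _ _ _)

instance : (twistedRepFunctor (Q := Q) hc).Linear ℂ where
  map_smul _ _ := TwistedRep.Hom.ext (funext fun _ => LinearMap.ext fun _ =>
    Linear.comp_smul _ _ _ _ _ _)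

/-- Morphisms out of `q · X` are determined by the elements `(q · m) ∘ a` of the spaces
`Hom(c_j, q · X)`. -/
theorem hom_ext_of_lineTranslate (hc : ∀ i, SimpleClass.mk (c i) = i) {q : Discrete Q} {X Y : C}
    {φ φ' : q ⊙ₗ X ⟶ Y}
    (h : ∀ (i j : ActionCategory Q (SimpleClass C)) (f : i ⟶ j) (_ : arrowLabel f = q)
      (a : (c j.back).obj ⟶ q ⊙ₗ (c i.back).obj) (m : (c i.back).obj ⟶ X),
      (a ≫ q ⊴ₗ m) ≫ φ = (a ≫ q ⊴ₗ m) ≫ φ') : φ = φ' := by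
  refine hom_ext_of_object (Q := Q) hc fun j x => ?_
  obtain ⟨i, f, rfl⟩ := exists_arrowLabel_eq q j
  obtain ⟨a⟩ := nonempty_gerbeLine_iso c hc f
  obtain ⟨m, rfl⟩ := (lineTranslate_bijective f X a.hom).2 x
  exact h i j f rfl a.hom m

instance : (twistedRepFunctor (Q := Q) hc).Faithful where
  map_injective h := EquivariantObject.Hom.ext (hom_ext_of_object (Q := Q) hc fun i x =>
    LinearMap.congr_fun (congrFun (congrArg TwistedRep.Hom.hom h) i) x)

/-- The family `T` comes from a morphism `φ` of `C` by semisimplicity. Evaluated on `(q · m) ∘ a`,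
the commutation of `φ` with `φ_q` is exactly the hypothesis `hT`, and such elements detect morphisms
out of `q · M`. -/
theorem exists_map_eq_of_family (hc : ∀ i, SimpleClass.mk (c i) = i)
    {M N : EquivariantObject Q C}
    (T : ∀ i : ActionCategory Q (SimpleClass C),
      ((c i.back).obj ⟶ M.obj) →ₗ[ℂ] ((c i.back).obj ⟶ N.obj))
    (hT : ∀ (i j : ActionCategory Q (SimpleClass C)) (f : i ⟶ j) (a : gerbeLine c f)
      (m : (c i.back).obj ⟶ M.obj), T j (equivariantAct M f a m) = equivariantAct N f a (T i m)) :
    ∃ φ : M ⟶ N, ∀ (i : ActionCategory Q (SimpleClass C)) (x : (c i.back).obj ⟶ M.obj),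
      x ≫ φ.hom = T i x := by
  obtain ⟨φ, hφ⟩ := exists_hom_of_object hc T
  refine ⟨⟨φ, fun q => hom_ext_of_lineTranslate hc ?_⟩, hφ⟩
  rintro i j f rfl a m
  have h := hT i j f a m
  rw [← hφ i, ← hφ j, equivariantAct_apply, equivariantAct_apply] at h
  simpa using h

instance : (twistedRepFunctor (Q := Q) hc).Full where
  map_surjective {M N} T := by
    obtain ⟨φ, hφ⟩ := exists_map_eq_of_family hc (M := M) (N := N) (fun i => T.hom i)
      (fun i j f a m => T.comm f a m)
    exact ⟨φ, TwistedRep.Hom.ext (funext fun i => LinearMap.ext fun x => hφ i x)⟩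

/-! ### Essential surjectivity -/

/-- The structure maps of a twisted representation, transported to the spaces `Hom(c_i, X)`, give
linear maps on `Hom(c_j, q · X)`. -/
theorem exists_transport_act (W : TwistedRep.{v} (equivariantGerbe (Q := Q) c hc)) {X : C}
    (ψ : ∀ i : ActionCategory Q (SimpleClass C), ((c i.back).obj ⟶ X) ≃ₗ[ℂ] W.space i)
    {i j : ActionCategory Q (SimpleClass C)} (f : i ⟶ j) :
    ∃ T : ((c j.back).obj ⟶ arrowLabel f ⊙ₗ X) →ₗ[ℂ] ((c j.back).obj ⟶ X),
      Function.Bijective T ∧ ∀ (a : gerbeLine c f) (m : (c i.back).obj ⟶ X),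
        T (a ≫ arrowLabel f ⊴ₗ m) = (ψ j).symm (W.act f a (ψ i m)) := by
  -- `T` is defined with one generator `a₀` of the line; the formula for general `a` follows since
  -- `a` is a multiple of `a₀` and both sides are linear in `a`.
  obtain ⟨a₀⟩ := nonempty_gerbeLine_iso c hc f
  have ha₀ : a₀.hom ≠ 0 := by
    have := (c j.back).simple
    intro h
    exact id_nonzero (c j.back).obj (by rw [← a₀.hom_inv_id, h, Limits.zero_comp])
  let E := LinearEquiv.ofBijective _ (lineTranslate_bijective f X a₀.hom)
  -- The line of the gerbe is `gerbeLine c f` by definition; `A` fixes the type so that linearity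
  -- rewrites apply.
  let A : gerbeLine c f →ₗ[ℂ] W.space i →ₗ[ℂ] W.space j := W.act f
  let T := (ψ j).symm.toLinearMap ∘ₗ A a₀.hom ∘ₗ (ψ i).toLinearMap ∘ₗ E.symm.toLinearMap
  refine ⟨T, ?_, fun a m => ?_⟩
  · exact (ψ j).symm.bijective.comp ((W.act_bijective f ha₀).comp
      ((ψ i).bijective.comp E.symm.bijective))
  · obtain ⟨r, rfl⟩ := exists_smul_eq_of_finrank_eq_one (finrank_gerbeLine c hc f) ha₀ a
    have h1 : E.symm (a₀.hom ≫ arrowLabel f ⊴ₗ m) = m := E.symm_apply_apply m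
    have h2 : T (a₀.hom ≫ arrowLabel f ⊴ₗ m) = (ψ j).symm (A a₀.hom (ψ i m)) := by
      simp only [T, LinearMap.comp_apply, LinearEquiv.coe_coe, h1]
    change _ = (ψ j).symm (A (r • a₀.hom) (ψ i m))
    rw [Linear.smul_comp, map_smul, h2, map_smul, LinearMap.smul_apply, map_smul]

/-- The action of `q` on an object underlying a twisted representation. -/
theorem exists_equivariant_iso (W : TwistedRep.{v} (equivariantGerbe (Q := Q) c hc)) {X : C}
    (ψ : ∀ i : ActionCategory Q (SimpleClass C), ((c i.back).obj ⟶ X) ≃ₗ[ℂ] W.space i)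
    (q : Discrete Q) :
    ∃ φ : (q ⊙ₗ X : C) ≅ X, ∀ (i j : ActionCategory Q (SimpleClass C)) (f : i ⟶ j)
      (hf : q = arrowLabel f) (a : gerbeLine c f) (m : (c i.back).obj ⟶ X),
      (a ≫ arrowLabel f ⊴ₗ m) ≫ eqToHom (by rw [hf]) ≫ φ.hom =
        (ψ j).symm (W.act f a (ψ i m)) := by
  have key : ∀ j : ActionCategory Q (SimpleClass C),
      ∃ T : ((c j.back).obj ⟶ q ⊙ₗ X) →ₗ[ℂ] ((c j.back).obj ⟶ X), Function.Bijective T ∧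
        ∀ (i : ActionCategory Q (SimpleClass C)) (f : i ⟶ j) (hf : q = arrowLabel f)
          (a : gerbeLine c f) (m : (c i.back).obj ⟶ X),
          T ((a ≫ arrowLabel f ⊴ₗ m) ≫ eqToHom (by rw [hf])) =
            (ψ j).symm (W.act f a (ψ i m)) := by
    intro j
    obtain ⟨i, f, rfl⟩ := exists_arrowLabel_eq q j
    obtain ⟨T, hT, h⟩ := exists_transport_act hc W ψ f
    refine ⟨T, hT, fun i' f' hf a m => ?_⟩
    -- The arrow into `j` labelled `q` is unique, so the formula for the chosen arrow is the formula
    -- for all.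
    cases arrow_ext hf
    rw [eqToHom_refl, Category.comp_id]
    exact h a m
  choose T hT hTact using key
  obtain ⟨φ, hφ⟩ := exists_hom_of_object hc T
  have : IsIso φ := isIso_of_object (Q := Q) hc φ fun i => by
    rw [show (fun x : (c i.back).obj ⟶ q ⊙ₗ X => x ≫ φ) = T i from funext (hφ i)]
    exact hT i
  refine ⟨asIso φ, fun i j f hf a m => ?_⟩
  rw [← hTact j i f hf a m, ← hφ, asIso_hom]
  simp only [Category.assoc]

/-- The equivariant structure on an object underlying a twisted representation. -/
theorem exists_equivariantObject (W : TwistedRep.{v} (equivariantGerbe (Q := Q) c hc)) {X : C}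
    (ψ : ∀ i : ActionCategory Q (SimpleClass C), ((c i.back).obj ⟶ X) ≃ₗ[ℂ] W.space i)
    (φ : ∀ q : Discrete Q, (q ⊙ₗ X : C) ≅ X)
    (hφ : ∀ (i j : ActionCategory Q (SimpleClass C)) (f : i ⟶ j) (a : gerbeLine c f)
      (m : (c i.back).obj ⟶ X), (a ≫ arrowLabel f ⊴ₗ m) ≫ (φ (arrowLabel f)).hom =
        (ψ j).symm (W.act f a (ψ i m))) :
    (φ (𝟙_ (Discrete Q))).hom = (λₗ X).hom ∧ ∀ p q : Discrete Q,
      (φ (p ⊗ q)).hom = (αₗ p q X).hom ≫ p ⊴ₗ (φ q).hom ≫ (φ p).hom := by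
  constructor
  -- A variable label `r` can be replaced by `arrowLabel (𝟙 i)` once the test object `i` is
  -- introduced; the same device serves for `pq` below.
  · suffices H : ∀ (r : Discrete Q) (h : r = 𝟙_ (Discrete Q)),
        (φ r).hom = (actionOneIso h X).hom by
      simpa [actionOneIso] using H _ rfl
    intro r h
    refine hom_ext_of_object (Q := Q) hc fun i x => ?_
    obtain rfl : r = arrowLabel (𝟙 i) := h
    have hiso : IsIso (gerbeOne c i) := by
      unfold gerbeOne
      infer_instance
    obtain ⟨m, rfl⟩ := (lineTranslate_bijective (𝟙 i) X (gerbeOne c i)).2 x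
    have h2 := hφ i i (𝟙 i) (gerbeOne c i) m
    have h3 : W.act (𝟙 i) (gerbeOne c i) (ψ i m) = ψ i m := W.one_act i (ψ i m)
    rw [h3, LinearEquiv.symm_apply_apply] at h2
    refine h2.trans ?_
    rw [lineTranslate_apply, Category.assoc]
    exact ((congrArg (gerbeOne c i ≫ ·) (actionOneIso_naturality (arrowLabel_id i) m)).symm.trans
      (Iso.inv_hom_id_assoc _ _)).symm
  · suffices H : ∀ p q r : Discrete Q, ∀ h : p ⊗ q = r,
        (φ r).hom = (actionMulIso h X).hom ≫ p ⊴ₗ (φ q).hom ≫ (φ p).hom by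
      intro p q
      simpa [actionMulIso] using H p q _ rfl
    intro p q r h
    refine hom_ext_of_object (Q := Q) hc fun k x => ?_
    obtain ⟨j, g, rfl⟩ := exists_arrowLabel_eq p k
    obtain ⟨i, f, rfl⟩ := exists_arrowLabel_eq q j
    obtain rfl : r = arrowLabel (f ≫ g) := h.symm.trans (arrowLabel_comp rfl)
    obtain ⟨a⟩ := nonempty_gerbeLine_iso c hc f
    obtain ⟨b⟩ := nonempty_gerbeLine_iso c hc g
    -- The product of invertible elements generates the line of `f ≫ g`, so every test map `c_k ⟶
    -- (pq) · X` is the translate of some `m` by it.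
    have hiso : IsIso (gerbeMul c rfl b.hom a.hom : gerbeLine c (f ≫ g)) := by
      rw [gerbeMul_apply]
      infer_instance
    obtain ⟨m, rfl⟩ := (lineTranslate_bijective (f ≫ g) X (gerbeMul c rfl b.hom a.hom)).2 x
    have h1 := hφ i _ (f ≫ g) (gerbeMul c rfl b.hom a.hom) m
    have h2 : W.act (f ≫ g) (gerbeMul c rfl b.hom a.hom) (ψ i m) =
      W.act g b.hom (W.act f a.hom (ψ i m)) := W.mul_act rfl b.hom a.hom (ψ i m)
    -- The defining formula for `φ_p` is applied to the output of `φ_q`, where `ψ` cancels the `ψ⁻¹`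
    -- in that output.
    have h3 := hφ _ _ g b.hom ((a.hom ≫ arrowLabel f ⊴ₗ m) ≫ (φ (arrowLabel f)).hom)
    rw [hφ i j f a.hom m, LinearEquiv.apply_symm_apply] at h3
    rw [h2, ← h3, ← hφ i j f a.hom m] at h1
    refine h1.trans ?_
    have h4 := congrArg (· ≫ arrowLabel g ⊴ₗ (φ (arrowLabel f)).hom ≫
      (φ (arrowLabel g)).hom) (gerbeMul_comp rfl b.hom a.hom m)
    rw [lineTranslate_apply]
    simpa using h4.symm

instance : (twistedRepFunctor (Q := Q) hc).EssSurj where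
  mem_essImage W := by
    obtain ⟨X, hX⟩ := exists_objectHom_linearEquiv hc W.space
    let ψ : ∀ i : ActionCategory Q (SimpleClass C), ((c i.back).obj ⟶ X) ≃ₗ[ℂ] W.space i :=
      fun i => (hX i).some
    choose φ hφ using exists_equivariant_iso hc W ψ
    have hφ' : ∀ (i j : ActionCategory Q (SimpleClass C)) (f : i ⟶ j) (a : gerbeLine c f)
        (m : (c i.back).obj ⟶ X), (a ≫ arrowLabel f ⊴ₗ m) ≫ (φ (arrowLabel f)).hom =
          (ψ j).symm (W.act f a (ψ i m)) := fun i j f a m => by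
      rw [← hφ (arrowLabel f) i j f rfl a m, eqToHom_refl, Category.id_comp]
    obtain ⟨h1, h2⟩ := exists_equivariantObject hc W ψ φ hφ'
    let M : EquivariantObject Q C := ⟨X, φ, h1, h2⟩
    refine ⟨M, ⟨TwistedRep.isoOfLinearEquiv (V := toTwistedRep hc M) ψ fun {i j} f a m => ?_⟩⟩
    exact (congrArg (ψ j) (hφ' i j f a m)).trans ((ψ j).apply_symm_apply _)

end Comparison

end

/-! ### The linear equivalence -/

theorem mainTheorem2 (C : Type u) [Category.{v} C] [Abelian C] [Linear ℂ C] [IsTwoVectorSpace C]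
    (Q : Type w) [Group Q] [Finite Q] [MonoidalLeftAction (Discrete Q) C] [IsLinearAction Q C]
    (c : SimpleClass C → SimpleObject C) (hc : ∀ i : SimpleClass C, SimpleClass.mk (c i) = i) :
    ∃ e : EquivariantObject Q C ≌ TwistedRep.{v} (equivariantGerbe (Q := Q) c hc),
      e.functor.Additive ∧ e.functor.Linear ℂ := by
  have : (twistedRepFunctor (Q := Q) hc).IsEquivalence := {}
  exact ⟨(twistedRepFunctor (Q := Q) hc).asEquivalence,
    (inferInstance : (twistedRepFunctor (Q := Q) hc).Additive),
    (inferInstance : (twistedRepFunctor (Q := Q) hc).Linear ℂ)⟩
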